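/- Let $X$ be a real Banach space, with closed unit ball $B_X$ and unit sphere $S_X$, and let $\mathcal G_X$ be the group of surjective linear isometries of $X$. Assume that $X$ is convex-transitive, that is, $\overline{\mathrm{conv}}\{T(x) : T\in\mathcal G_X\}=B_X$ for every $x\in S_X$. Let $u\in S_X$ and suppose that there is a bicontractive projection $P$ of $X$ onto the line $[u]=\mathbb R u$, that is, a continuous linear map $P\colon X\to X$ with $P^2=P$, $P(X)=[u]$ and $\|P\|=\|I-P\|=1$. Assume further: (i) The set of weakly exposed points of $B_X$ is norm dense in $S_X$. Here $x\in S_X$ is weakly exposed if there is $f\in S_{X^*}$ such that every sequence $(x_n)\subset B_X$ with $f(x_n)\to 1$ converges weakly to $x$. (ii) The set-valued map $u\circ J\colon (S_X,\text{weak})\to\mathcal P([-1,1])$, $x\mapsto\{g(u) : g\in J(x)\}$, where $J(x)=\{g\in S_{X^*} : g(x)=1\}$ is the duality map, is upper semicontinuous at $u$: for each open $V\subset[-1,1]$ containing $(u\circ J)(u)$ there is a weakly open neighbourhood $U$ of $u$ in $S_X$ such that $(u\circ J)(x)\subset V$ for all $x\in U$. Then $X$ is (linearly isometric to) a Hilbert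 space. -/

import Mathlib

open Filter Topology

universe v

/-- The orbit of `x` under the group of rotations (surjective linear isometries) of `X`. -/
def rotationOrbit {X : Type v} [NormedAddCommGroup X] [NormedSpace ℝ X] (x : X) : Set X :=
  Set.range fun T : X ≃ₗᵢ[ℝ] X => T x

/-- A big point: a unit vector whose orbit under the rotations has the whole closed unit ball as its
closed convex hull. -/
def IsBigPoint {X : Type v} [NormedAddCommGroup X] [NormedSpace ℝ X] (x : X) : Prop :=
  ‖x‖ = 1 ∧ closure (convexHull ℝ (rotationOrbit x)) = Metric.closedBall (0 : X) 1

/-- Every unit vector is a big point. -/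
def IsConvexTransitive (X : Type v) [NormedAddCommGroup X] [NormedSpace ℝ X] : Prop :=
  ∀ x ∈ Metric.sphere (0 : X) 1, IsBigPoint x

/-- `P` is a bicontractive linear projection onto the line `[u]`:
a projection with range `[u]` and `‖P‖ = ‖I - P‖ = 1`. -/
structure IsBicontractiveProjectionOnto {X : Type v} [NormedAddCommGroup X] [NormedSpace ℝ X]
    (P : X →L[ℝ] X) (u : X) : Prop where
  apply_apply : ∀ x, P (P x) = P x
  range_eq : Set.range P = (Submodule.span ℝ {u} : Set X)
  norm_eq : ‖P‖ = 1
  norm_compl_eq : ‖ContinuousLinearMap.id ℝ X - P‖ = 1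

/-- `f` weakly exposes the unit vector `x` in the closed unit ball. -/
def WeaklyExposes {X : Type v} [NormedAddCommGroup X] [NormedSpace ℝ X]
    (f : StrongDual ℝ X) (x : X) : Prop :=
  ‖f‖ = 1 ∧ ∀ y : ℕ → X, (∀ n, y n ∈ Metric.closedBall (0 : X) 1) →
    Tendsto (fun n => f (y n)) atTop (𝓝 1) →
    Tendsto (fun n => toWeakSpace ℝ X (y n)) atTop (𝓝 (toWeakSpace ℝ X x))

/-- The set of weakly exposed points of the closed unit ball. -/
def weaklyExposedPoints (X : Type v) [NormedAddCommGroup X] [NormedSpace ℝ X] : Set X :=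
  {x | ‖x‖ = 1 ∧ ∃ f : StrongDual ℝ X, WeaklyExposes f x}

/-- The duality map `J`: the norm-one functionals that take the value `1` at `x`. -/
def dualityMap {X : Type v} [NormedAddCommGroup X] [NormedSpace ℝ X] (x : X) :
    Set (StrongDual ℝ X) :=
  {f | ‖f‖ = 1 ∧ f x = 1}

/-- The unit sphere of `X`; as a subtype of `WeakSpace ℝ X` it carries the weak topology. -/
abbrev WeakSphere (X : Type v) [NormedAddCommGroup X] [NormedSpace ℝ X] : Type v :=
  {x : WeakSpace ℝ X // ‖(toWeakSpace ℝ X).symm x‖ = 1}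

/-- A unit vector as a point of the unit sphere with the weak topology. -/
noncomputable def WeakSphere.mk {X : Type v} [NormedAddCommGroup X] [NormedSpace ℝ X] (x : X) (hx : ‖x‖ = 1) :
    WeakSphere X :=
  ⟨toWeakSpace ℝ X x, by simpa using hx⟩

/-- The set-valued map `u ∘ J : x ↦ {g u | g ∈ J x}`, from the unit sphere with the weak topology to
the subsets of `[-1, 1]`. For a unit vector `u` all the values `g u` lie in `[-1, 1]`. -/
def evalDuality {X : Type v} [NormedAddCommGroup X] [NormedSpace ℝ X] (u : X)
    (x : WeakSphere X) : Set (Set.Icc (-1 : ℝ) 1) :=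
  {t | ∃ g ∈ dualityMap ((toWeakSpace ℝ X).symm x.1), g u = t}

/-- `X` is linearly isometric to a real Hilbert space. -/
def IsIsometricallyHilbert (X : Type v) [NormedAddCommGroup X] [NormedSpace ℝ X] : Prop :=
  ∃ (H : Type v) (_ : NormedAddCommGroup H) (_ : InnerProductSpace ℝ H) (_ : CompleteSpace H),
    Nonempty (X ≃ₗᵢ[ℝ] H)

/-! The goal is the parallelogram law. In finite dimension, averaging squared functionals over the
dual ball gives a rotation-invariant quadratic form, which convex transitivity forces to be a
multiple of `‖·‖ ^ 2`. In infinite dimension, rotations carry the support functional of `P` to weak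
limits: by upper semicontinuity every weakly exposed point, then by density every unit vector, spans
the range of a contractive projection along a support functional with contractive complement. Weak
exposure then makes the norm smooth, and smoothness makes orthogonality `F x y = 0` symmetric
(`exists_isSymmetricSupport`). For pairwise orthogonal `x`, `y`, `z`, symmetry gives functional
equations for the slope of the support functional at `x + t • y`, so the slope is linear in `t`
(`supportSlope_eq`). Integrating it gives Pythagoras for orthogonal vectors, hence the parallelogram
law. -/

/-! ### Transport of contractive supports, and smoothness of the norm. -/

section ContractiveFunctionals

variable {X : Type*} [NormedAddCommGroup X] [NormedSpace ℝ X]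

/-- `f` is a support functional at the unit vector `x` for which the projection
`y ↦ y - f y • x` along `x` is contractive. -/
structure IsContractiveSupport (f : StrongDual ℝ X) (x : X) : Prop where
  norm_le : ‖f‖ ≤ 1
  apply_self : f x = 1
  norm_sub_le : ∀ y, ‖y - f y • x‖ ≤ ‖y‖

theorem apply_le_norm {f : StrongDual ℝ X} (hf : ‖f‖ ≤ 1) (y : X) : f y ≤ ‖y‖ :=
  (le_abs_self _).trans ((f.le_opNorm y).trans (mul_le_of_le_one_left (norm_nonneg y) hf))

theorem continuous_weakSpace_apply (g : StrongDual ℝ X) :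
    Continuous fun x : WeakSpace ℝ X => g ((toWeakSpace ℝ X).symm x) :=
  WeakBilin.eval_continuous (topDualPairing ℝ X).flip g

theorem tendsto_apply_of_weak {ι : Type*} {F : Filter ι} {y : ι → X} {x : X}
    (h : Tendsto (fun i => toWeakSpace ℝ X (y i)) F (𝓝 (toWeakSpace ℝ X x)))
    (g : StrongDual ℝ X) : Tendsto (fun i => g (y i)) F (𝓝 (g x)) :=
  ((continuous_weakSpace_apply g).tendsto _).comp h

/-- Contractive supports pass to weak limits of the points, as long as the limiting value at the
limit point is `1`. -/
theorem exists_isContractiveSupport_of_tendsto {ι : Type*} {F : Filter ι} [F.NeBot]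
    {f : ι → StrongDual ℝ X} {v : ι → X} {x : X} (hf : ∀ i, ‖f i‖ ≤ 1)
    (hc : ∀ i y, ‖y - f i y • v i‖ ≤ ‖y‖)
    (hv : ∀ g : StrongDual ℝ X, Tendsto (fun i => g (v i)) F (𝓝 (g x)))
    (hx : Tendsto (fun i => f i x) F (𝓝 1)) : ∃ g, IsContractiveSupport g x := by
  obtain ⟨φ, hφ, hlim⟩ := (WeakDual.isCompact_closedBall (𝕜 := ℝ) (E := X) 0 1).ultrafilter_le_nhds
    ((Ultrafilter.of F).map fun i => StrongDual.toWeakDual (f i)) (by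
      rw [le_principal_iff]
      refine Ultrafilter.mem_coe.2 (Ultrafilter.mem_map.2 (Filter.univ_mem' fun i => ?_))
      simpa using hf i)
  have hle : ((Ultrafilter.of F : Ultrafilter ι) : Filter ι) ≤ F := Ultrafilter.of_le F
  have hev : ∀ y, Tendsto (fun i => f i y) (Ultrafilter.of F : Ultrafilter ι)
      (𝓝 (WeakDual.toStrongDual φ y)) := fun y =>
    ((WeakDual.eval_continuous y).tendsto φ).comp
      (show Tendsto (fun i => StrongDual.toWeakDual (f i)) (Ultrafilter.of F : Ultrafilter ι) (𝓝 φ)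
        from hlim)
  refine ⟨WeakDual.toStrongDual φ, by simpa using hφ,
    tendsto_nhds_unique (hev x) (hx.mono_left hle), fun y => ?_⟩
  -- A norming functional reduces the norm bound to a limit of scalars, where weak convergence of
  -- `v` and weak-star convergence of `f` can be multiplied.
  obtain ⟨g, hg, hgv⟩ := exists_dual_vector'' ℝ (y - WeakDual.toStrongDual φ y • x)
  have hg' : g (y - WeakDual.toStrongDual φ y • x) ≤ ‖y‖ := by
    have h1 : Tendsto (fun i => g y - f i y * g (v i)) (Ultrafilter.of F : Ultrafilter ι)
        (𝓝 (g y - WeakDual.toStrongDual φ y * g x)) :=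
      tendsto_const_nhds.sub ((hev y).mul ((hv g).mono_left hle))
    rw [map_sub, map_smul, smul_eq_mul]
    refine le_of_tendsto h1 (Eventually.of_forall fun i => ?_)
    have := (apply_le_norm hg _).trans (hc i y)
    simpa using this
  rw [hgv] at hg'
  simpa using hg'

theorem WeaklyExposes.apply_eq_one {f : StrongDual ℝ X} {x : X} (h : WeaklyExposes f x) :
    f x = 1 := by
  have hex : ∀ n : ℕ, ∃ y : X, y ∈ Metric.closedBall (0 : X) 1 ∧ 1 - 1 / ((n : ℝ) + 1) < f y := by
    intro n
    obtain ⟨y, hy, hlt⟩ := f.exists_lt_apply_of_lt_opNorm (r := 1 - 1 / ((n : ℝ) + 1)) (by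
      rw [h.1]; linarith [Nat.one_div_pos_of_nat (α := ℝ) (n := n)])
    rcases abs_cases (f y) with ⟨he, -⟩ | ⟨he, -⟩
    · exact ⟨y, by simpa using hy.le, by rwa [Real.norm_eq_abs, he] at hlt⟩
    · exact ⟨-y, by simpa using hy.le, by rwa [Real.norm_eq_abs, he, ← map_neg] at hlt⟩
  choose y hy hlt using hex
  have hlim : Tendsto (fun n => f (y n)) atTop (𝓝 1) := by
    refine tendsto_of_tendsto_of_tendsto_of_le_of_le (g := fun n : ℕ => 1 - 1 / ((n : ℝ) + 1))
      (h := fun _ => 1) ?_ tendsto_const_nhds (fun n => (hlt n).le) fun n => ?_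
    · simpa using (tendsto_one_div_add_atTop_nhds_zero_nat (𝕜 := ℝ)).const_sub 1
    · exact (apply_le_norm h.1.le _).trans (by simpa using hy n)
  exact tendsto_nhds_unique (tendsto_apply_of_weak (h.2 y hy hlim) f) hlim

/-- The orbit of a big point approaches each weakly exposed point weakly. -/
theorem IsBigPoint.exists_seq_tendsto {x : X} (hx : IsBigPoint x) {f : StrongDual ℝ X} {e : X}
    (he : ‖e‖ = 1) (h : WeaklyExposes f e) : ∃ T : ℕ → X ≃ₗᵢ[ℝ] X,
      Tendsto (fun n => toWeakSpace ℝ X (T n x)) atTop (𝓝 (toWeakSpace ℝ X e)) := by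
  have hex : ∀ n : ℕ, ∃ T : X ≃ₗᵢ[ℝ] X, 1 - 1 / ((n : ℝ) + 1) < f (T x) := by
    intro n
    -- Otherwise a closed half-space missing `e` contains the orbit, hence the whole ball.
    by_contra! hn
    have hsub : closure (convexHull ℝ (rotationOrbit x)) ⊆
        {y | f y ≤ 1 - 1 / ((n : ℝ) + 1)} := by
      refine closure_minimal (convexHull_min ?_ ?_) (isClosed_le f.continuous continuous_const)
      · rintro _ ⟨T, rfl⟩
        exact hn T
      · exact convex_halfSpace_le f.toLinearMap.isLinear _
    have := hsub (by rw [hx.2]; simp [he] : e ∈ _)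
    rw [Set.mem_ofPred_eq, h.apply_eq_one] at this
    linarith [Nat.one_div_pos_of_nat (α := ℝ) (n := n)]
  choose T hT using hex
  have hball : ∀ n, T n x ∈ Metric.closedBall (0 : X) 1 := fun n => by simp [hx.1]
  refine ⟨T, h.2 _ hball ?_⟩
  refine tendsto_of_tendsto_of_tendsto_of_le_of_le (g := fun n : ℕ => 1 - 1 / ((n : ℝ) + 1))
    (h := fun _ => 1) ?_ tendsto_const_nhds (fun n => (hT n).le) fun n => ?_
  · simpa using (tendsto_one_div_add_atTop_nhds_zero_nat (𝕜 := ℝ)).const_sub 1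
  · exact (apply_le_norm h.1.le _).trans (by simpa using hball n)

/-- The coordinate functional of a bicontractive projection onto `[u]`. -/
theorem IsBicontractiveProjectionOnto.exists_isContractiveSupport {P : X →L[ℝ] X} {u : X}
    (hu : ‖u‖ = 1) (hP : IsBicontractiveProjectionOnto P u) : ∃ f, IsContractiveSupport f u := by
  obtain ⟨g, hg, hgu⟩ := exists_dual_vector ℝ u (by simp [hu])
  have hgu' : g u = 1 := by simpa [hu] using hgu
  have hmem : ∀ x, P x = g (P x) • u := by
    intro x
    have : P x ∈ Set.range P := ⟨x, rfl⟩
    rw [hP.range_eq] at this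
    obtain ⟨a, ha⟩ := Submodule.mem_span_singleton.1 this
    rw [← ha]; simp [hgu']
  have hPu : P u = u := by
    have : u ∈ Set.range P := by
      rw [hP.range_eq]; exact Submodule.mem_span_singleton_self u
    obtain ⟨y, rfl⟩ := this
    exact hP.apply_apply y
  refine ⟨g ∘L P, ?_, by simp [hPu, hgu'], fun y => ?_⟩
  · refine (g.opNorm_comp_le P).trans ?_
    rw [hg, hP.norm_eq, one_mul]
  · have := (ContinuousLinearMap.id ℝ X - P).le_opNorm y
    rw [hP.norm_compl_eq, one_mul] at this
    simpa [← hmem y] using this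

/-- Upper semicontinuity of `u ∘ J` at `u`, in terms of norm-one support functionals. -/
theorem eventually_lt_apply_of_upperHemicontinuousAt {u : X} (hu : ‖u‖ = 1)
    (husc : UpperHemicontinuousAt (evalDuality u) (WeakSphere.mk u hu)) {c : ℝ} (hc : c < 1) :
    ∀ᶠ x in 𝓝 (WeakSphere.mk u hu), ∀ g ∈ dualityMap ((toWeakSpace ℝ X).symm x.1), c < g u := by
  have hev := husc.forall_isOpen {t : Set.Icc (-1 : ℝ) 1 | c < t}
    (isOpen_lt continuous_const continuous_subtype_val) (by
      rintro t ⟨g, hg, hgt⟩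
      have h1 : g u = 1 := hg.2
      rw [Set.mem_ofPred_eq, ← hgt, h1]
      exact hc)
  filter_upwards [hev] with x hx g hg
  have hgu : |g u| ≤ 1 := by simpa [hg.1, hu] using g.le_opNorm u
  exact hx (show (⟨g u, abs_le.1 hgu⟩ : Set.Icc (-1 : ℝ) 1) ∈ evalDuality u x from ⟨g, hg, rfl⟩)

/-- Rotations `T` are found with `T e` weakly near `u` and, simultaneously, `T.symm u` weakly near
`e`; the functionals `f ∘ T`, which are contractive supports at `T.symm u`, then accumulate at one
for `e`. -/
theorem exists_isContractiveSupport_of_weaklyExposes {u : X} (hX : IsConvexTransitive X)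
    (hu : ‖u‖ = 1) {f : StrongDual ℝ X} (hf : IsContractiveSupport f u)
    (hexp : Metric.sphere (0 : X) 1 ⊆ closure (weaklyExposedPoints X))
    (husc : UpperHemicontinuousAt (evalDuality u) (WeakSphere.mk u hu))
    {e : X} (he : ‖e‖ = 1) {h : StrongDual ℝ X} (hh : WeaklyExposes h e) :
    ∃ g, IsContractiveSupport g e := by
  have key : ∀ n : ℕ, ∃ T : X ≃ₗᵢ[ℝ] X, 1 - 1 / ((n : ℝ) + 1) < f (T e) ∧
      1 - 1 / ((n : ℝ) + 1) < h (T.symm u) := by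
    intro n
    have hc : 1 - 1 / ((n : ℝ) + 1) < 1 := by linarith [Nat.one_div_pos_of_nat (α := ℝ) (n := n)]
    have hf' : ∀ᶠ x in 𝓝 (WeakSphere.mk u hu),
        1 - 1 / ((n : ℝ) + 1) < f ((toWeakSpace ℝ X).symm x.1) := by
      refine ((continuous_weakSpace_apply f).comp continuous_subtype_val).continuousAt.eventually
        (lt_mem_nhds ?_)
      simpa [WeakSphere.mk, hf.apply_self] using hc
    have hev := hf'.and (eventually_lt_apply_of_upperHemicontinuousAt hu husc hc)
    rw [nhds_subtype_eq_comap, eventually_comap] at hev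
    obtain ⟨U, hU, hUo, huU⟩ := eventually_nhds_iff.1 hev
    -- The orbit of `e` is only known to approach weakly exposed points, so one is chosen close to
    -- `u`.
    obtain ⟨e', ⟨he', h', hexp'⟩, hmem⟩ : ∃ e' ∈ weaklyExposedPoints X, toWeakSpace ℝ X e' ∈ U := by
      have : (toWeakSpaceCLM ℝ X) ⁻¹' U ∈ 𝓝 u :=
        (hUo.preimage (toWeakSpaceCLM ℝ X).continuous).mem_nhds huU
      obtain ⟨y, hy, hy'⟩ := mem_closure_iff_nhds.1 (hexp (by simp [hu] : u ∈ _)) _ this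
      exact ⟨y, hy', hy⟩
    obtain ⟨T, hT⟩ := (hX e (by simp [he])).exists_seq_tendsto he' hexp'
    obtain ⟨k, hk⟩ := (hT.eventually (hUo.mem_nhds hmem)).exists
    have hTe : ‖T k e‖ = 1 := by simp [he]
    have := hU _ hk (WeakSphere.mk (T k e) hTe) rfl
    -- Since `h ∘ T⁻¹` supports the ball at `T e`, semicontinuity makes its value at `u` close to 1.
    refine ⟨T k, this.1, this.2 (h ∘L (T k).symm.toContinuousLinearEquiv.toContinuousLinearMap)
      ⟨?_, ?_⟩⟩
    · refine le_antisymm (ContinuousLinearMap.opNorm_le_bound _ zero_le_one fun y => ?_) ?_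
      · simpa [hh.1] using h.le_opNorm ((T k).symm y)
      · have := (h ∘L (T k).symm.toContinuousLinearEquiv.toContinuousLinearMap).le_opNorm (T k e)
        rw [hTe, mul_one] at this
        simpa [hh.apply_eq_one] using this
    · simp [WeakSphere.mk, hh.apply_eq_one]
  choose T hT using key
  have hone : Tendsto (fun n : ℕ => 1 - 1 / ((n : ℝ) + 1)) atTop (𝓝 1) := by
    simpa using (tendsto_one_div_add_atTop_nhds_zero_nat (𝕜 := ℝ)).const_sub 1
  have hv : Tendsto (fun n => toWeakSpace ℝ X ((T n).symm u)) atTop (𝓝 (toWeakSpace ℝ X e)) := by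
    refine hh.2 _ (fun n => by simp [hu]) ?_
    refine tendsto_of_tendsto_of_tendsto_of_le_of_le hone tendsto_const_nhds
      (fun n => (hT n).2.le) fun n => ?_
    exact (apply_le_norm hh.1.le _).trans (by simp [hu])
  refine exists_isContractiveSupport_of_tendsto (F := atTop)
    (f := fun n => f ∘L (T n).toContinuousLinearEquiv.toContinuousLinearMap)
    (v := fun n => (T n).symm u) (fun n => ?_) (fun n y => ?_) (tendsto_apply_of_weak hv) ?_
  · refine ContinuousLinearMap.opNorm_le_bound _ zero_le_one fun y => ?_
    simpa using f.le_of_opNorm_le hf.norm_le (T n y)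
  · have := hf.norm_sub_le (T n y)
    rw [← (T n).symm.norm_map] at this
    simpa using this
  · refine tendsto_of_tendsto_of_tendsto_of_le_of_le hone tendsto_const_nhds
      (fun n => (hT n).1.le) fun n => ?_
    exact (apply_le_norm hf.norm_le _).trans (by simp [he])

theorem exists_isContractiveSupport_of_mem_closure {A : Set X}
    (hA : ∀ e ∈ A, ∃ f, IsContractiveSupport f e) {x : X} (hx : x ∈ closure A) :
    ∃ f, IsContractiveSupport f x := by
  obtain ⟨e, heA, he⟩ := mem_closure_iff_seq_limit.1 hx
  choose f hf using fun n => hA (e n) (heA n)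
  refine exists_isContractiveSupport_of_tendsto (fun n => (hf n).norm_le)
    (fun n => (hf n).norm_sub_le) (fun g => (g.continuous.tendsto x).comp he) ?_
  rw [tendsto_iff_norm_sub_tendsto_zero]
  refine squeeze_zero (fun n => norm_nonneg _) (fun n => ?_)
    (tendsto_iff_norm_sub_tendsto_zero.1 he)
  rw [← (hf n).apply_self, ← map_sub, norm_sub_rev (e n) x]
  simpa using (f n).le_of_opNorm_le (hf n).norm_le (x - e n)

/-- If the weakly exposed points are dense in the sphere and every unit vector has a contractive
support, then the norm is smooth. -/
theorem smooth_of_forall_exists_isContractiveSupport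
    (hS : ∀ x : X, ‖x‖ = 1 → ∃ f, IsContractiveSupport f x)
    (hexp : Metric.sphere (0 : X) 1 ⊆ closure (weaklyExposedPoints X)) {x : X} (hx : ‖x‖ = 1)
    {f g : StrongDual ℝ X} (hf : ‖f‖ ≤ 1) (hfx : f x = 1) (hg : ‖g‖ ≤ 1) (hgx : g x = 1) :
    f = g := by
  by_contra hne
  obtain ⟨w, hw⟩ : ∃ w, g w < f w := by
    obtain ⟨w, hw⟩ : ∃ w, f w ≠ g w := by
      by_contra! hall
      exact hne (ContinuousLinearMap.ext hall)
    rcases hw.lt_or_gt with hw | hw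
    · exact ⟨-w, by simpa using hw⟩
    · exact ⟨w, hw⟩
  set U : Set X := {y | 0 < f y ∧ g y < 0} with hUdef
  have hUo : IsOpen U := (isOpen_lt continuous_const f.continuous).inter
    (isOpen_lt g.continuous continuous_const)
  obtain ⟨y₀, hy₀⟩ : U.Nonempty := by
    refine ⟨w - ((f w + g w) / 2) • x, ?_, ?_⟩ <;> simp [hfx, hgx] <;> linarith
  have hy₀n : 0 < ‖y₀‖ := by
    rw [norm_pos_iff]; rintro rfl; simp [hUdef] at hy₀
  have hy₁ : ‖y₀‖⁻¹ • y₀ ∈ U := by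
    have := inv_pos.2 hy₀n
    refine ⟨?_, ?_⟩
    · simpa using mul_pos this hy₀.1
    · simpa using mul_neg_of_pos_of_neg this hy₀.2
  obtain ⟨y, hyU, hy1, k, hk⟩ := mem_closure_iff.1
    (hexp (by simp [norm_smul, hy₀n.ne'] : ‖y₀‖⁻¹ • y₀ ∈ Metric.sphere (0 : X) 1)) U hUo hy₁
  -- Testing `‖x - F x • z/‖z‖‖ ≤ 1` with `f` and `g`, of opposite signs at `z`, forces `F x = 0`.
  have hinv : ∀ z ∈ U, ∀ t : ℝ, ‖z‖ ≤ ‖z + t • x‖ := by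
    intro z hz t
    have hzn : 0 < ‖z‖ := by
      rw [norm_pos_iff]; rintro rfl; simp [hUdef] at hz
    obtain ⟨F, hF⟩ := hS (‖z‖⁻¹ • z) (by simp [norm_smul, hzn.ne'])
    have hFz : F z = ‖z‖ := by
      have := hF.apply_self
      rw [map_smul, smul_eq_mul] at this
      field_simp at this
      exact this
    have hle := hF.norm_sub_le x
    have h1 := (apply_le_norm hf _).trans hle
    have h2 := (apply_le_norm hg _).trans hle
    rw [hx] at h1 h2
    simp only [map_sub, map_smul, smul_eq_mul, hfx, hgx] at h1 h2
    have hi := inv_pos.2 hzn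
    have h3 : 0 ≤ F x := by
      by_contra! hlt
      have := mul_neg_of_neg_of_pos hlt (mul_pos hi hz.1)
      linarith
    have h4 : F x ≤ 0 := by
      by_contra! hlt
      have := mul_neg_of_pos_of_neg hlt (mul_neg_of_pos_of_neg hi hz.2)
      linarith
    have := apply_le_norm hF.norm_le (z + t • x)
    simpa [le_antisymm h4 h3, hFz] using this
  obtain ⟨ε, hε, hball⟩ := Metric.isOpen_iff.1 hUo y hyU
  have hmem : ∀ s : ℝ, |s| < ε → y + s • x ∈ U := fun s hs =>
    hball (by simpa [norm_smul, hx] using hs)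
  have hnorm : ∀ s : ℝ, |s| < ε → ‖y + s • x‖ ≤ 1 := by
    intro s hs
    have := hinv _ (hmem s hs) (-s)
    simpa [hy1] using this
  have hkx : ∀ s : ℝ, |s| < ε → s * k x ≤ 0 := by
    intro s hs
    have := (apply_le_norm hk.1.le _).trans (hnorm s hs)
    simp only [map_add, map_smul, smul_eq_mul, hk.apply_eq_one] at this
    linarith
  have hkx0 : k x = 0 := by
    have h1 := hkx (ε / 2) (by rw [abs_of_pos (by positivity)]; linarith)
    have h2 := hkx (-(ε / 2)) (by rw [abs_neg, abs_of_pos (by positivity)]; linarith)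
    nlinarith
  -- The ball contains a segment through `y` in direction `x` on which `k` is 1; a constant sequence
  -- at another of its points contradicts exposure of `y`.
  have hlim := hk.2 (fun _ => y + (ε / 2) • x)
    (fun _ => by
      simpa using hnorm (ε / 2) (by rw [abs_of_pos (by positivity)]; linarith))
    (by simp [hk.apply_eq_one, hkx0])
  have := tendsto_nhds_unique (tendsto_apply_of_weak hlim f) tendsto_const_nhds
  simp [hfx] at this
  linarith

end ContractiveFunctionals

/-! ### The finite-dimensional case, by an invariant quadratic form. -/

section FiniteDimensional

open MeasureTheory

variable {X : Type*} [NormedAddCommGroup X] [NormedSpace ℝ X]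

/-- The quadratic form obtained by averaging the squares of the functionals in the dual unit
ball. -/
noncomputable def dualBallForm [MeasurableSpace (StrongDual ℝ X)]
    [BorelSpace (StrongDual ℝ X)] (x : X) : ℝ :=
  ∫ φ in Metric.closedBall (0 : StrongDual ℝ X) 1, (φ x) ^ 2
    ∂(Measure.hausdorffMeasure (Module.finrank ℝ (StrongDual ℝ X)))

variable [MeasurableSpace (StrongDual ℝ X)] [BorelSpace (StrongDual ℝ X)]

/-- Composition with `T` is an isometry of the dual fixing its ball, and Hausdorff measure is
preserved by every isometry. -/
theorem dualBallForm_map (T : X ≃ₗᵢ[ℝ] X) (x : X) : dualBallForm (T x) = dualBallForm x := by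
  have hnorm : ∀ (S : X ≃ₗᵢ[ℝ] X) (φ : StrongDual ℝ X),
      ‖φ ∘L S.toContinuousLinearEquiv.toContinuousLinearMap‖ ≤ ‖φ‖ := fun S φ =>
    ContinuousLinearMap.opNorm_le_bound _ (norm_nonneg _) fun y => by
      simpa using φ.le_opNorm (S y)
  let A : StrongDual ℝ X ≃ᵢ StrongDual ℝ X := IsometryEquiv.mk'
    (fun φ => φ ∘L T.toContinuousLinearEquiv.toContinuousLinearMap)
    (fun φ => φ ∘L T.symm.toContinuousLinearEquiv.toContinuousLinearMap)
    (fun φ => by ext y; simp)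
    (by
      refine Isometry.of_dist_eq fun φ ψ => ?_
      rw [dist_eq_norm, dist_eq_norm, ← ContinuousLinearMap.sub_comp]
      refine le_antisymm (hnorm T _) ?_
      have h := hnorm T.symm ((φ - ψ) ∘L T.toContinuousLinearEquiv.toContinuousLinearMap)
      have h2 : ((φ - ψ) ∘L T.toContinuousLinearEquiv.toContinuousLinearMap) ∘L
          T.symm.toContinuousLinearEquiv.toContinuousLinearMap = φ - ψ := by
        ext y; simp
      rwa [h2] at h)
  have hA0 : A 0 = 0 :=
    ContinuousLinearMap.zero_comp T.toContinuousLinearEquiv.toContinuousLinearMap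
  have hpre : A ⁻¹' Metric.closedBall 0 1 = Metric.closedBall 0 1 := by
    have := A.preimage_closedBall 0 1
    rwa [A.symm_apply_eq.2 hA0.symm] at this
  have h := (A.measurePreserving_hausdorffMeasure
    (Module.finrank ℝ (StrongDual ℝ X))).setIntegral_preimage_emb
      A.toHomeomorph.measurableEmbedding (fun φ => (φ x) ^ 2) (Metric.closedBall 0 1)
  rw [hpre] at h
  exact h

theorem dualBallForm_smul (c : ℝ) (x : X) : dualBallForm (c • x) = c ^ 2 * dualBallForm x := by
  unfold dualBallForm
  rw [← integral_const_mul]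
  refine integral_congr_ae (Eventually.of_forall fun φ => ?_)
  simp only [map_smul, smul_eq_mul]
  ring

variable [FiniteDimensional ℝ X]

theorem integrableOn_dualBall {k : StrongDual ℝ X → ℝ} (hk : Continuous k) :
    IntegrableOn k (Metric.closedBall (0 : StrongDual ℝ X) 1)
      (Measure.hausdorffMeasure (Module.finrank ℝ (StrongDual ℝ X))) :=
  hk.continuousOn.integrableOn_compact (isCompact_closedBall _ _)

theorem dualBallForm_parallelogram (x y : X) :
    dualBallForm (x + y) + dualBallForm (x - y) = 2 * (dualBallForm x + dualBallForm y) := by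
  unfold dualBallForm
  rw [← integral_add (integrableOn_dualBall (by fun_prop)) (integrableOn_dualBall (by fun_prop)),
    ← integral_add (integrableOn_dualBall (by fun_prop)) (integrableOn_dualBall (by fun_prop)),
    ← integral_const_mul]
  refine integral_congr_ae (Eventually.of_forall fun φ => ?_)
  simp only [map_add, map_sub]
  ring

theorem dualBallForm_pos {x : X} (hx : x ≠ 0) : 0 < dualBallForm x := by
  unfold dualBallForm
  rw [setIntegral_pos_iff_support_of_nonneg_ae (Eventually.of_forall fun φ => sq_nonneg _)
    (integrableOn_dualBall (by fun_prop))]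
  have hopen : IsOpen ({φ : StrongDual ℝ X | φ x ≠ 0} ∩ Metric.ball 0 1) :=
    (isOpen_ne_fun (by fun_prop) continuous_const).inter Metric.isOpen_ball
  obtain ⟨g, hg, hgx⟩ := exists_dual_vector ℝ x (norm_ne_zero_iff.2 hx)
  have hne : ({φ : StrongDual ℝ X | φ x ≠ 0} ∩ Metric.ball 0 1).Nonempty := by
    refine ⟨(1 / 2 : ℝ) • g, ?_, ?_⟩
    · simpa [hgx] using hx
    · rw [mem_ball_zero_iff, norm_smul, hg]; norm_num
  refine (hopen.measure_pos _ hne).trans_le (measure_mono ?_)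
  refine Set.inter_subset_inter (fun φ hφ => ?_) Metric.ball_subset_closedBall
  exact pow_ne_zero 2 hφ

theorem convexOn_dualBallForm : ConvexOn ℝ Set.univ (dualBallForm (X := X)) := by
  refine ⟨convex_univ, fun x _ y _ a b ha hb hab => ?_⟩
  unfold dualBallForm
  rw [smul_eq_mul, smul_eq_mul, ← integral_const_mul, ← integral_const_mul,
    ← integral_add ((integrableOn_dualBall (by fun_prop)).const_mul a)
      ((integrableOn_dualBall (by fun_prop)).const_mul b)]
  refine setIntegral_mono (integrableOn_dualBall (by fun_prop))
    (integrableOn_dualBall (by fun_prop)) fun φ => ?_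
  simp only [map_add, map_smul, smul_eq_mul]
  have hb' : b = 1 - a := by linarith
  subst hb'
  nlinarith [mul_nonneg (mul_nonneg ha hb) (sq_nonneg (φ x - φ y))]

end FiniteDimensional

theorem IsConvexTransitive.parallelogram_of_finiteDimensional {X : Type*} [NormedAddCommGroup X]
    [NormedSpace ℝ X] [FiniteDimensional ℝ X] (hX : IsConvexTransitive X) (x y : X) :
    ‖x + y‖ ^ 2 + ‖x - y‖ ^ 2 = 2 * (‖x‖ ^ 2 + ‖y‖ ^ 2) := by
  let _ : MeasurableSpace (StrongDual ℝ X) := borel _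
  have : BorelSpace (StrongDual ℝ X) := ⟨rfl⟩
  rcases eq_or_ne x 0 with rfl | hx
  · simp; ring
  -- A closed convex sublevel set containing the orbit of `v` contains the ball; exchanging `v` and
  -- `w` makes the form constant on the sphere.
  have hle : ∀ v w : X, ‖v‖ = 1 → ‖w‖ = 1 → dualBallForm w ≤ dualBallForm v := by
    intro v w hv hw
    have hsub : closure (convexHull ℝ (rotationOrbit v)) ⊆
        {z | dualBallForm z ≤ dualBallForm v} := by
      refine closure_minimal (convexHull_min ?_ ?_) (isClosed_le ?_ continuous_const)
      · rintro _ ⟨T, rfl⟩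
        exact (dualBallForm_map T v).le
      · simpa using convexOn_dualBallForm.convex_le (dualBallForm v)
      · exact convexOn_dualBallForm.locallyLipschitz.continuous
    refine hsub ?_
    rw [(hX v (by simp [hv])).2]
    simp [hw]
  have hunit : ∀ z : X, z ≠ 0 → ‖‖z‖⁻¹ • z‖ = 1 := fun z hz => by
    simp [norm_smul, norm_ne_zero_iff.2 hz]
  set c := dualBallForm (‖x‖⁻¹ • x) with hc
  have hcpos : 0 < c := dualBallForm_pos (by
    rw [← norm_ne_zero_iff, hunit x hx]; exact one_ne_zero)
  have hform : ∀ z : X, dualBallForm z = c * ‖z‖ ^ 2 := by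
    intro z
    rcases eq_or_ne z 0 with rfl | hz
    · simpa using dualBallForm_smul (X := X) 0 0
    · have h1 : dualBallForm (‖z‖⁻¹ • z) = c :=
        le_antisymm (hle _ _ (hunit x hx) (hunit z hz)) (hle _ _ (hunit z hz) (hunit x hx))
      rw [dualBallForm_smul] at h1
      have := norm_ne_zero_iff.2 hz
      field_simp at h1
      linarith
  have h := dualBallForm_parallelogram x y
  simp only [hform] at h
  refine mul_left_cancel₀ hcpos.ne' ?_
  linarith

/-! ### Two facts about real functions, used for slopes and norms. -/

section RealFunctions

/-- A function that is multiplicative up to a constant, monotone on the positive reals, and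
involutive under `t ↦ -t⁻¹`, is linear. -/
theorem eq_mul_of_multiplicative_of_involutive {S : ℝ → ℝ} (hpos : ∀ t, t ≠ 0 → 0 < t * S t)
    (hmono : ∀ a b, 0 < a → a ≤ b → S a ≤ S b) (hmul : ∀ t q, S (t * q) * S 1 = S t * S q)
    (hinv : ∀ t, t ≠ 0 → S (-(S t)⁻¹) = -t⁻¹) (t : ℝ) : S t = S 1 * t := by
  have hK : 0 < S 1 := by simpa using hpos 1 one_ne_zero
  have hneg : S (-1) = -S 1 := by
    have h1 := hmul (-1) (-1)
    have h2 := hpos (-1) (by norm_num)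
    norm_num at h1
    nlinarith
  have hodd : ∀ t, S (-t) = -S t := by
    intro t
    have := hmul (-1) t
    rw [hneg, neg_one_mul] at this
    exact mul_right_cancel₀ hK.ne' (by linarith)
  have hinv' : ∀ t, t ≠ 0 → S (S t)⁻¹ = t⁻¹ := fun t ht => by
    have := hinv t ht
    rw [hodd] at this
    linarith
  have hSS : ∀ t, t ≠ 0 → S (S t) = S 1 ^ 2 * t := by
    intro t ht
    have hSt : S t ≠ 0 := fun h => by simpa [h] using hpos t ht
    have := hmul (S t)⁻¹ (S t)
    rw [inv_mul_cancel₀ hSt, hinv' t ht] at this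
    field_simp at this
    linarith
  have hposS : ∀ t, 0 < t → 0 < S t := fun t ht => pos_of_mul_pos_right (hpos t ht.ne') ht.le
  have hmm : ∀ t, 0 < t → S (S t / S 1) = S 1 * t := by
    intro t ht
    have h1 := hmul (S t / S 1) (S 1)
    have h2 := hSS 1 one_ne_zero
    rw [div_mul_cancel₀ _ hK.ne', hSS t ht.ne', h2] at h1
    refine mul_right_cancel₀ (pow_ne_zero 2 hK.ne') ?_
    linarith
  -- On the positive reals `S / S 1` is a monotone involution, hence the identity.
  have hmain : ∀ t, 0 < t → S t = S 1 * t := by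
    intro t ht
    have hm : 0 < S t / S 1 := div_pos (hposS t ht) hK
    have hmt := hmm t ht
    rcases lt_trichotomy (S t / S 1) t with h | h | h
    · have := hmono _ _ hm h.le
      rw [hmt] at this
      rw [div_lt_iff₀ hK] at h
      linarith
    · rw [div_eq_iff hK.ne'] at h
      linarith
    · have := hmono _ _ ht h.le
      rw [hmt] at this
      rw [lt_div_iff₀ hK] at h
      linarith
  rcases lt_trichotomy t 0 with h | rfl | h
  · have := hmain (-t) (neg_pos.2 h)
    rw [hodd] at this
    linarith
  · have := hodd 0
    rw [neg_zero] at this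
    linarith
  · exact hmain t h

/-- A continuous function with subgradient `K t n(t) / (1 + K t²)` has
`n(t)² = n(0)² (1 + K t²)`. -/
theorem sq_eq_of_subgradient {n : ℝ → ℝ} {K : ℝ} (hK : 0 < K) (hn : Continuous n)
    (hsub : ∀ t s, n t + (s - t) * (K * t * n t / (1 + K * t ^ 2)) ≤ n s) (t : ℝ) :
    n t ^ 2 = n 0 ^ 2 * (1 + K * t ^ 2) := by
  have hpos : ∀ t : ℝ, 0 < 1 + K * t ^ 2 := fun t => by positivity
  set b : ℝ → ℝ := fun t => K * t * n t / (1 + K * t ^ 2) with hb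
  have hbc : Continuous b :=
    Continuous.div (by fun_prop) (by fun_prop) fun t => (hpos t).ne'
  have hderiv : ∀ t, HasDerivAt n (b t) t := by
    intro t
    rw [hasDerivAt_iff_isLittleO, Asymptotics.isLittleO_iff]
    intro c hc
    filter_upwards [Metric.continuousAt_iff'.1 hbc.continuousAt c hc] with s hs
    rw [Real.dist_eq] at hs
    rw [Real.norm_eq_abs, Real.norm_eq_abs, smul_eq_mul]
    have h1 := hsub t s
    have h2 := hsub s t
    -- The subgradient inequalities at `t` and `s` squeeze the remainder between 0 and `(s - t) * (b
    -- s - b t)`.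
    have h3 : 0 ≤ n s - n t - (s - t) * b t := by linarith
    rw [abs_of_nonneg h3]
    calc n s - n t - (s - t) * b t ≤ (s - t) * (b s - b t) := by linarith
      _ ≤ |(s - t) * (b s - b t)| := le_abs_self _
      _ = |b s - b t| * |s - t| := by rw [abs_mul, mul_comm]
      _ ≤ c * |s - t| := by gcongr
  have hconst := is_const_of_deriv_eq_zero (f := fun t => n t ^ 2 / (1 + K * t ^ 2))
    (fun t => (((hderiv t).pow 2).div (((hasDerivAt_pow 2 t).const_mul K).const_add 1)
      (hpos t).ne').differentiableAt)
    (fun t => by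
      have h := (((hderiv t).pow 2).div (((hasDerivAt_pow 2 t).const_mul K).const_add 1)
        (hpos t).ne').deriv
      refine h.trans ?_
      have := (hpos t).ne'
      simp only [hb, Pi.pow_apply]
      field_simp
      ring) t 0
  have := (hpos t).ne'
  simp only [ne_eq, OfNat.ofNat_ne_zero, not_false_eq_true, zero_pow, mul_zero, add_zero,
    div_one] at hconst
  field_simp at hconst
  linarith

end RealFunctions

/-! ### Symmetric orthogonality and the parallelogram law. -/

section SymmetricSupports

variable {X : Type*} [NormedAddCommGroup X] [NormedSpace ℝ X]

/-- A selection of support functionals for which the relation `F x y = 0` is symmetric. -/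
structure IsSymmetricSupport (F : X → StrongDual ℝ X) : Prop where
  norm_le : ∀ x, ‖F x‖ ≤ 1
  apply_self : ∀ x, F x x = ‖x‖
  symm : ∀ {x y}, F x y = 0 → F y x = 0
  mul_nonneg : ∀ x y, 0 ≤ F x y * F y x

/-- The slope of the kernel of `F (x + t y)` in the plane spanned by `x` and `y`. -/
noncomputable def supportSlope (F : X → StrongDual ℝ X) (x y : X) (t : ℝ) : ℝ :=
  F (x + t • y) y / F (x + t • y) x

namespace IsSymmetricSupport

variable {F : X → StrongDual ℝ X} {x y z : X}

theorem pos_of_pos (hF : IsSymmetricSupport F) (h : 0 < F x y) : 0 < F y x := by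
  have h1 := hF.mul_nonneg x y
  have h2 : F y x ≠ 0 := fun h0 => h.ne' (hF.symm h0)
  exact lt_of_le_of_ne (nonneg_of_mul_nonneg_right h1 h) h2.symm

theorem apply_left_pos (hF : IsSymmetricSupport F) (hxy : F x y = 0) (hx : x ≠ 0) (t : ℝ) :
    0 < F (x + t • y) x :=
  hF.pos_of_pos (by simpa [hxy, hF.apply_self] using hx)

theorem mul_apply_right_pos (hF : IsSymmetricSupport F) (hxy : F x y = 0) (hy : y ≠ 0) {t : ℝ}
    (ht : t ≠ 0) : 0 < t * F (x + t • y) y := by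
  have h1 : F y (x + t • y) = t * ‖y‖ := by simp [hF.symm hxy, hF.apply_self]
  have h2 := hF.mul_nonneg y (x + t • y)
  have hy' : 0 < ‖y‖ := norm_pos_iff.2 hy
  have h3 : F (x + t • y) y ≠ 0 := fun h0 => by
    have := hF.symm h0
    rw [h1] at this
    exact mul_ne_zero ht hy'.ne' this
  rw [h1] at h2
  refine lt_of_le_of_ne (nonneg_of_mul_nonneg_right (a := ‖y‖) ?_ hy') (mul_ne_zero ht h3).symm
  linarith

theorem mul_supportSlope_pos (hF : IsSymmetricSupport F) (hxy : F x y = 0) (hx : x ≠ 0)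
    (hy : y ≠ 0) {t : ℝ} (ht : t ≠ 0) : 0 < t * supportSlope F x y t := by
  rw [supportSlope, ← mul_div_assoc]
  exact div_pos (hF.mul_apply_right_pos hxy hy ht) (hF.apply_left_pos hxy hx t)

theorem supportSlope_mul (hF : IsSymmetricSupport F) (hxy : F x y = 0) (hx : x ≠ 0) (t : ℝ) :
    supportSlope F x y t * F (x + t • y) x = F (x + t • y) y :=
  div_mul_cancel₀ _ (hF.apply_left_pos hxy hx t).ne'

theorem add_mul_apply_le (hF : IsSymmetricSupport F) (x y : X) (t s : ℝ) :
    ‖x + t • y‖ + (s - t) * F (x + t • y) y ≤ ‖x + s • y‖ := by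
  have h := apply_le_norm (hF.norm_le (x + t • y)) (x + s • y)
  have h2 := hF.apply_self (x + t • y)
  have h3 : x + s • y = (x + t • y) + (s - t) • y := by module
  rw [h3, map_add, h2, map_smul, smul_eq_mul, ← h3] at h
  exact h

/-- By convexity of `t ↦ ‖x + t • y‖`, for `t > 0` the numerator of the slope increases and the
denominator decreases. -/
theorem supportSlope_mono (hF : IsSymmetricSupport F) (hxy : F x y = 0) (hx : x ≠ 0)
    (hy : y ≠ 0) {a b : ℝ} (ha : 0 < a) (hab : a ≤ b) :
    supportSlope F x y a ≤ supportSlope F x y b := by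
  rcases hab.eq_or_lt with rfl | hlt
  · exact le_rfl
  have hA := hF.apply_left_pos hxy hx a
  have hB := hF.apply_left_pos hxy hx b
  have hAy : 0 < F (x + a • y) y :=
    pos_of_mul_pos_right (hF.mul_apply_right_pos hxy hy ha.ne') ha.le
  have h1 := hF.add_mul_apply_le x y a b
  have h2 := hF.add_mul_apply_le x y b a
  have h3 := hF.apply_self (x + a • y)
  have h4 := hF.apply_self (x + b • y)
  rw [map_add, map_smul, smul_eq_mul] at h3 h4
  have hyy : F (x + a • y) y ≤ F (x + b • y) y :=
    le_of_mul_le_mul_left (a := b - a) (by linarith) (by linarith)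
  have hxx : F (x + b • y) x ≤ F (x + a • y) x := by
    nlinarith
  exact div_le_div₀ (hAy.le.trans hyy) hyy hB hxx

/-- The slope in the plane of `x, y` also governs the supports at points with an additional
component orthogonal to this plane. -/
theorem apply_eq_supportSlope_mul (hF : IsSymmetricSupport F) (hxy : F x y = 0) (hx : x ≠ 0)
    (hzx : F z x = 0) (hzy : F z y = 0) (t c r : ℝ) :
    F (c • (x + t • y) + r • z) y = supportSlope F x y t * F (c • (x + t • y) + r • z) x := by
  -- Symmetry puts both `x + t • y` and `z` in the linear kernel of `F w`; symmetry applied to their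
  -- combination returns the claim.
  set w := y - supportSlope F x y t • x with hw
  have h1 : F w (x + t • y) = 0 := hF.symm (by
    rw [hw, map_sub, map_smul, smul_eq_mul, hF.supportSlope_mul hxy hx, sub_self])
  have h2 : F w z = 0 := hF.symm (by simp [hw, hzx, hzy])
  have h3 : F (c • (x + t • y) + r • z) w = 0 := hF.symm (by
    rw [map_add, map_smul, map_smul, h1, h2]; simp)
  rw [hw, map_sub, map_smul, smul_eq_mul] at h3
  linarith

/-- At `v = x + t • y + (t * q) • z`, each of the three coordinate planes computes one ratio among
`F v x`, `F v y`, `F v z`. -/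
theorem supportSlope_chain (hF : IsSymmetricSupport F) (hx : x ≠ 0) (hy : y ≠ 0)
    (hxy : F x y = 0) (hxz : F x z = 0) (hyz : F y z = 0) (t q : ℝ) :
    supportSlope F x z (t * q) = supportSlope F y z q * supportSlope F x y t := by
  have h1 := hF.apply_eq_supportSlope_mul hxy hx (hF.symm hxz) (hF.symm hyz) t 1 (t * q)
  have h2 := hF.apply_eq_supportSlope_mul hxz hx (hF.symm hxy) hyz (t * q) 1 t
  have h3 := hF.apply_eq_supportSlope_mul hyz hy hxy hxz q t 1
  have e2 : (1 : ℝ) • (x + (t * q) • z) + t • y = (1 : ℝ) • (x + t • y) + (t * q) • z := by module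
  have e3 : t • (y + q • z) + (1 : ℝ) • x = (1 : ℝ) • (x + t • y) + (t * q) • z := by module
  rw [e2] at h2
  rw [e3] at h3
  set v := (1 : ℝ) • (x + t • y) + (t * q) • z
  have hv : F v x ≠ 0 := (hF.pos_of_pos (by simpa [v, hxy, hxz, hF.apply_self] using hx)).ne'
  refine mul_right_cancel₀ hv ?_
  rw [← h2, h3, h1, mul_assoc]

/-- The vector `x - S⁻¹ • y`, with `S` the slope at `t`, is orthogonal to `x + t • y`; symmetry
exchanges their roles. -/
theorem supportSlope_neg_inv (hF : IsSymmetricSupport F) (hxy : F x y = 0) (hx : x ≠ 0)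
    (hy : y ≠ 0) {t : ℝ} (ht : t ≠ 0) :
    supportSlope F x y (-(supportSlope F x y t)⁻¹) = -t⁻¹ := by
  have hS : supportSlope F x y t ≠ 0 := fun h => by
    simpa [h] using hF.mul_supportSlope_pos hxy hx hy ht
  have h1 : F (x + (-(supportSlope F x y t)⁻¹) • y) (x + t • y) = 0 := hF.symm (by
    rw [map_add, map_smul, smul_eq_mul, ← hF.supportSlope_mul hxy hx]
    field_simp
    ring)
  have h2 := hF.apply_left_pos hxy hx (-(supportSlope F x y t)⁻¹)
  rw [map_add, map_smul, smul_eq_mul] at h1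
  rw [supportSlope, div_eq_iff h2.ne']
  generalize x + (-(supportSlope F x y t)⁻¹) • y = w at h1 h2 ⊢
  field_simp
  linarith

theorem supportSlope_eq (hF : IsSymmetricSupport F) (hx : x ≠ 0) (hy : y ≠ 0) (hz : z ≠ 0)
    (hxy : F x y = 0) (hxz : F x z = 0) (hyz : F y z = 0) (t : ℝ) :
    supportSlope F x y t = supportSlope F x y 1 * t := by
  refine eq_mul_of_multiplicative_of_involutive
    (fun t ht => hF.mul_supportSlope_pos hxy hx hy ht)
    (fun a b ha hab => hF.supportSlope_mono hxy hx hy ha hab) (fun t q => ?_)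
    (fun t ht => hF.supportSlope_neg_inv hxy hx hy ht) t
  have hc := hF.supportSlope_chain hx hy hxy hxz hyz
  have hpos : 0 < supportSlope F y z 1 := by
    simpa using hF.mul_supportSlope_pos hyz hy hz one_ne_zero
  have h1 := hc t q
  have h2 := hc 1 q
  have h3 := hc (t * q) 1
  have h4 := hc q 1
  rw [one_mul] at h2
  rw [mul_one] at h3 h4
  refine mul_left_cancel₀ hpos.ne' ?_
  calc supportSlope F y z 1 * (supportSlope F x y (t * q) * supportSlope F x y 1)
      = (supportSlope F y z q * supportSlope F x y t) * supportSlope F x y 1 := by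
        rw [← h1, h3]; ring
    _ = supportSlope F x y t * (supportSlope F y z q * supportSlope F x y 1) := by ring
    _ = supportSlope F y z 1 * (supportSlope F x y t * supportSlope F x y q) := by
        rw [← h2, h4]; ring

theorem exists_norm_add_smul_sq (hF : IsSymmetricSupport F) (hx : x ≠ 0) (hy : y ≠ 0)
    (hz : z ≠ 0) (hxy : F x y = 0) (hxz : F x z = 0) (hyz : F y z = 0) :
    ∃ K : ℝ, ∀ t : ℝ, ‖x + t • y‖ ^ 2 = ‖x‖ ^ 2 * (1 + K * t ^ 2) := by
  have hK : 0 < supportSlope F x y 1 := by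
    simpa using hF.mul_supportSlope_pos hxy hx hy one_ne_zero
  refine ⟨supportSlope F x y 1, fun t => ?_⟩
  have h := sq_eq_of_subgradient (n := fun t : ℝ => ‖x + t • y‖) hK (by fun_prop) (fun t s => ?_) t
  · simpa using h
  -- With slope `K * t`, the norm at `t` is `(1 + K * t ^ 2) * F (x + t • y) x`, which gives the
  -- subgradient required.
  · convert hF.add_mul_apply_le x y t s using 3
    have h1 := hF.supportSlope_mul hxy hx t
    rw [hF.supportSlope_eq hx hy hz hxy hxz hyz t] at h1
    have h2 := hF.apply_self (x + t • y)
    rw [map_add, map_smul, smul_eq_mul, ← h1] at h2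
    rw [← h2, ← h1, div_eq_iff (by positivity)]
    ring

theorem norm_add_sq (hF : IsSymmetricSupport F) (hx : x ≠ 0) (hy : y ≠ 0) (hz : z ≠ 0)
    (hxy : F x y = 0) (hxz : F x z = 0) (hyz : F y z = 0) :
    ‖x + y‖ ^ 2 = ‖x‖ ^ 2 + ‖y‖ ^ 2 := by
  obtain ⟨K, hK⟩ := hF.exists_norm_add_smul_sq hx hy hz hxy hxz hyz
  obtain ⟨K', hK'⟩ := hF.exists_norm_add_smul_sq hy hx hz (hF.symm hxy) hyz hxz
  have h1 := hK 1
  have h1' := hK' 1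
  have h2 := hK 2
  have h2' := hK' (1 / 2)
  -- Comparing both expansions at a second vector, besides `x + y`, forces `K * ‖x‖ ^ 2 = ‖y‖ ^ 2`.
  have e : x + (2 : ℝ) • y = (2 : ℝ) • (y + (1 / 2 : ℝ) • x) := by module
  rw [one_smul] at h1 h1'
  rw [add_comm y x] at h1'
  rw [e, norm_smul, mul_pow, h2'] at h2
  norm_num at h2
  linarith

/-- A normed space of infinite dimension with symmetric supports satisfies the parallelogram law. -/
theorem parallelogram (hF : IsSymmetricSupport F) (hX : ¬ FiniteDimensional ℝ X) (a b : X) :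
    ‖a + b‖ ^ 2 + ‖a - b‖ ^ 2 = 2 * (‖a‖ ^ 2 + ‖b‖ ^ 2) := by
  rcases eq_or_ne a 0 with rfl | ha
  · simp; ring
  have hpyth : ∀ x y : X, F x y = 0 → ‖x + y‖ ^ 2 = ‖x‖ ^ 2 + ‖y‖ ^ 2 := by
    intro x y hxy
    rcases eq_or_ne x 0 with rfl | hx
    · simp
    rcases eq_or_ne y 0 with rfl | hy
    · simp
    -- Two functionals cannot separate points in infinite dimension.
    obtain ⟨z, hz, hxz, hyz⟩ : ∃ z : X, z ≠ 0 ∧ F x z = 0 ∧ F y z = 0 := by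
      by_contra! hno
      refine hX (FiniteDimensional.of_injective
        ((F x).toLinearMap.prod (F y).toLinearMap) ?_)
      rw [injective_iff_map_eq_zero]
      intro z hz
      by_contra hz0
      have h := Prod.ext_iff.1 hz
      exact hno z hz0 h.1 h.2
    exact hF.norm_add_sq hx hy hz hxy hxz hyz
  have ha' : ‖a‖ ≠ 0 := norm_ne_zero_iff.2 ha
  set c : ℝ := F a b / ‖a‖ with hc
  set y : X := b - c • a with hy
  have hay : F a y = 0 := by
    rw [hy, map_sub, map_smul, smul_eq_mul, hF.apply_self, hc, div_mul_cancel₀ _ ha', sub_self]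
  have hgen : ∀ r s : ℝ, ‖r • a + s • y‖ ^ 2 = r ^ 2 * ‖a‖ ^ 2 + s ^ 2 * ‖y‖ ^ 2 := by
    intro r s
    have h0 : F (r • a) (s • y) = 0 := by
      have h1 : F (s • y) a = 0 := hF.symm (by rw [map_smul, hay, smul_zero])
      exact hF.symm (by rw [map_smul, h1, smul_zero])
    rw [hpyth _ _ h0, norm_smul, norm_smul, mul_pow, mul_pow, Real.norm_eq_abs, Real.norm_eq_abs,
      sq_abs, sq_abs]
  have e1 : a + b = (1 + c) • a + (1 : ℝ) • y := by rw [hy]; module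
  have e2 : a - b = (1 - c) • a + (-1 : ℝ) • y := by rw [hy]; module
  have e3 : b = c • a + (1 : ℝ) • y := by rw [hy]; module
  rw [e1, e2, hgen, hgen]
  conv_rhs => rw [e3, hgen]
  ring

end IsSymmetricSupport

theorem exists_isSymmetricSupport
    (hS : ∀ x : X, ‖x‖ = 1 → ∃ f, IsContractiveSupport f x)
    (hsm : ∀ x : X, ‖x‖ = 1 → ∀ f g : StrongDual ℝ X, ‖f‖ ≤ 1 → f x = 1 → ‖g‖ ≤ 1 → g x = 1 →
      f = g) : ∃ F : X → StrongDual ℝ X, IsSymmetricSupport F := by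
  have hex : ∀ x : X, ∃ f : StrongDual ℝ X, (x = 0 → f = 0) ∧
      (x ≠ 0 → IsContractiveSupport f (‖x‖⁻¹ • x)) := by
    intro x
    rcases eq_or_ne x 0 with rfl | hx
    · exact ⟨0, by simp⟩
    · obtain ⟨f, hf⟩ := hS (‖x‖⁻¹ • x) (by simp [norm_smul, hx])
      exact ⟨f, by simp [hx], fun _ => hf⟩
  choose F hF0 hF using hex
  have hself : ∀ x, F x x = ‖x‖ := by
    intro x
    rcases eq_or_ne x 0 with rfl | hx
    · simp
    · have := (hF x hx).apply_self
      have hx' := norm_ne_zero_iff.2 hx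
      rw [map_smul, smul_eq_mul] at this
      field_simp at this
      exact this
  have hle : ∀ x, ‖F x‖ ≤ 1 := by
    intro x
    rcases eq_or_ne x 0 with rfl | hx
    · simp [hF0]
    · exact (hF x hx).norm_le
  refine ⟨F, hle, hself, fun {x y} hxy => ?_, fun x y => ?_⟩
  · rcases eq_or_ne x 0 with rfl | hx
    · simp
    rcases eq_or_ne y 0 with rfl | hy
    · simp [hF0]
    have hx' := norm_ne_zero_iff.2 hx
    have hy' := norm_ne_zero_iff.2 hy
    -- `g` is `F y` composed with the contractive projection along `x`; it still supports at `y`, so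
    -- smoothness gives `g = F y`, while `g` kills `x`.
    set g : StrongDual ℝ X := F y - (F y (‖x‖⁻¹ • x)) • F x with hg
    have hgv : ∀ z, g z = F y (z - F x z • (‖x‖⁻¹ • x)) := by
      intro z
      simp only [hg, sub_apply, smul_apply, map_sub,
        map_smul, smul_eq_mul]
      ring
    have hgn : ‖g‖ ≤ 1 := ContinuousLinearMap.opNorm_le_bound _ zero_le_one fun z => by
      rw [hgv, one_mul]
      refine ((F y).le_of_opNorm_le (hle y) _).trans ?_
      rw [one_mul]
      exact (hF x hx).norm_sub_le z
    have hgy : g (‖y‖⁻¹ • y) = 1 := by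
      rw [hgv, map_smul (F x), hxy]
      simpa using (hF y hy).apply_self
    have hgF := hsm _ (by simp [norm_smul, hy]) g (F y) hgn hgy (hle y) (hF y hy).apply_self
    rw [← hgF, hgv, hself, smul_smul, mul_inv_cancel₀ hx', one_smul, sub_self, map_zero]
  · rcases eq_or_ne x 0 with rfl | hx
    · simp
    rcases eq_or_ne y 0 with rfl | hy
    · simp
    have hx' := norm_pos_iff.2 hx
    -- Testing contractivity at `y` against `F y` itself gives the sign.
    have h := (apply_le_norm (hle y) _).trans ((hF x hx).norm_sub_le y)
    simp only [map_sub, map_smul, smul_eq_mul, hself] at h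
    have h2 : 0 ≤ ‖x‖⁻¹ * (F x y * F y x) := by linarith
    exact nonneg_of_mul_nonneg_right h2 (inv_pos.2 hx')

end SymmetricSupports

theorem theorem5p1 {X : Type*} [NormedAddCommGroup X] [NormedSpace ℝ X] [CompleteSpace X]
    (hX : IsConvexTransitive X)
    (u : X) (hu : ‖u‖ = 1)
    (P : X →L[ℝ] X) (hP : IsBicontractiveProjectionOnto P u)
    (hexp : Metric.sphere (0 : X) 1 ⊆ closure (weaklyExposedPoints X))
    (husc : UpperHemicontinuousAt (evalDuality u) (WeakSphere.mk u hu)) :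
    IsIsometricallyHilbert X := by
  have hpar : ∀ x y : X, ‖x + y‖ ^ 2 + ‖x - y‖ ^ 2 = 2 * (‖x‖ ^ 2 + ‖y‖ ^ 2) := by
    by_cases hfin : FiniteDimensional ℝ X
    · exact hX.parallelogram_of_finiteDimensional
    · obtain ⟨f, hf⟩ := hP.exists_isContractiveSupport hu
      have hS : ∀ x : X, ‖x‖ = 1 → ∃ g, IsContractiveSupport g x := fun x hx =>
        exists_isContractiveSupport_of_mem_closure (A := weaklyExposedPoints X)
          (fun e ⟨he, h, hh⟩ =>
            exists_isContractiveSupport_of_weaklyExposes hX hu hf hexp husc he hh)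
          (hexp (by simp [hx]))
      obtain ⟨F, hF⟩ := exists_isSymmetricSupport hS fun x hx f g hf hfx hg hgx =>
        smooth_of_forall_exists_isContractiveSupport hS hexp hx hf hfx hg hgx
      exact hF.parallelogram hfin
  exact ⟨X, inferInstance, InnerProductSpace.ofNorm ℝ fun x y => by
    simpa only [sq] using hpar x y, inferInstance, ⟨LinearIsometryEquiv.refl ℝ X⟩⟩
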